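/- Let $(a_n)_{n\ge 0}$ be complex numbers with $|a_n|=1$ for all $n$, and put $$f(z)=\sum_{n=0}^\infty \frac{a_n}{n!}z^n\quad(z\in\mathbb C),\qquad G(z)=\sum_{n=1}^\infty a_{n-1}z^n\quad(|z|<1).$$ Let $h_f(\theta)=\limsup_{r\to\infty} r^{-1}\log|f(re^{i\theta})|$ be the Phragmén–Lindelöf indicator of $f$ (with $\log 0=-\infty$). (Theorem 1) One has $h_f(\theta)\ge 0$ for every real $\theta$, unless there are a constant $c\in\mathbb C$ and a point $a$ of the unit circle with $a_n=c\,a^n$ for all $n\ge 0$. In the exceptional case $|c|=1$ and $f(z)=c\,e^{az}$ for all $z$, and $h_f$ is negative in some direction. (Theorem 1$'$) The function $G$ has no analytic continuation to $\infty$ through any half-plane containing $0$, unless $a_n=c\,a^n$ for all $n\ge 0$ with constants $c,a\in\mathbb C$ (then necessarily $|c|=|a|=1$). In the exceptional case such a continuation exists for some open half-plane containing $0$. Here an analytic continuation of $G$ to $\infty$ through an open half-plane $H$ means an analytic function on $\{|z|<1\}\cup H$ that equals $G$ in the unit disc and that coincides, at all points of $H$ of large modulus, with a function analytic in a neighbourhood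 of the point $\infty$ of the Riemann sphere (including $\infty$ itself). -/

import Mathlib

open Filter Topology

noncomputable section

/-- The function `f(z) = ∑ aₙ zⁿ / n!`. -/
def expTypeSeries (a : ℕ → ℂ) (z : ℂ) : ℂ :=
  ∑' n : ℕ, a n * z ^ n / (n.factorial : ℂ)

/-- The power series `G(z) = ∑_{n ≥ 1} a_{n-1} zⁿ` (with the index shifted to start at `0`);
it is only evaluated in the open unit disc. -/
def shiftedPowerSeries (a : ℕ → ℂ) (z : ℂ) : ℂ :=
  ∑' n : ℕ, a n * z ^ (n + 1)

/-- The Phragmén–Lindelöf indicator (for order one)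
`h_f(θ) = limsup_{r → ∞} r⁻¹ log |f(r e^{iθ})|`, with values in `[-∞, ∞]` and `log 0 = -∞`. -/
def plIndicator (f : ℂ → ℂ) (θ : ℝ) : EReal :=
  limsup (fun r : ℝ =>
    ((r⁻¹ : ℝ) : EReal) * ENNReal.log ‖f ((r : ℂ) * Complex.exp ((θ : ℂ) * Complex.I))‖ₑ) atTop

/-- `H` is an open half-plane `{z : Re (u z) < t}`, `u ≠ 0`. -/
def IsOpenHalfPlane (H : Set ℂ) : Prop :=
  ∃ (u : ℂ) (t : ℝ), u ≠ 0 ∧ H = {z : ℂ | (u * z).re < t}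

/-- `g`, given in the open unit disc, has an analytic continuation to the point `∞` of the
Riemann sphere through the set `H`: there is an analytic function `Φ` on the union of the unit
disc and `H` that equals `g` in the unit disc, and a function analytic in a neighbourhood of `∞`,
namely `z ↦ Ψ (1 / z)` with `Ψ` analytic at `0`, that equals `Φ` at all points of `H` of large
modulus. -/
def ContinuesToInftyThrough (g : ℂ → ℂ) (H : Set ℂ) : Prop :=
  ∃ Φ Ψ : ℂ → ℂ,
    AnalyticOnNhd ℂ Φ (Metric.ball 0 1 ∪ H) ∧
    (∀ z ∈ Metric.ball (0 : ℂ) 1, Φ z = g z) ∧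
    AnalyticAt ℂ Ψ 0 ∧
    ∃ R : ℝ, ∀ z ∈ H, R < ‖z‖ → Φ z = Ψ z⁻¹

/-- `aₙ = const · bⁿ` for some `b` on the unit circle. -/
def IsUnimodularGeometric (a : ℕ → ℂ) : Prop :=
  ∃ c b : ℂ, ‖b‖ = 1 ∧ ∀ n : ℕ, a n = c * b ^ n

end

/-!
Both parts rest on the Borel transform `B w = ∑ aₙ / w ^ (n + 1) = G (1 / w)`, which is holomorphic
for `|w| > 1`. After a rotation `aₙ ↦ aₙ vⁿ`, a negative indicator means that `f` decays
exponentially along the negative axis, and then the Laplace transform of `f` continues `B` to a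
half-plane `Re w < δ` with `δ > 0`. A continuation of `G` to `∞` through a half-plane containing `0`
gives such a continuation of `B` directly: under `w = 1 / z` the half-plane becomes the complement
of a closed disc that touches `0` from the right, and the function given near `∞` fills in a
neighbourhood of `0`.

In `isUnimodularGeometric_of_continuation` the singularities of such a `B` therefore lie in
`{|w| ≤ R₀, Re w ≥ δ}`, which is enclosed by a circle contained in the open right half-plane. The
moments `F z = (2πi)⁻¹ ∮ B w * w ^ z dw` over this circle define an entire function of exponential
type with `F n = aₙ` for all natural `n`. As the circle is seen from `0` under an angle less than
`π`, the type of `F` in the vertical directions is less than `π / 2`. Hence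
`F z * conj (F (conj z)) - 1`, which vanishes at the natural numbers because `|aₙ| = 1`, has vertical
type less than `π`, and Carlson's theorem (`carlson`) says that it vanishes identically. So `F` has
no zeros, and a zero-free entire function of exponential type is the exponential of an affine
function (`exists_exp_affine_of_ne_zero`); thus `aₙ = F 0 * (exp α) ^ n`.

Conversely, for `aₙ = c bⁿ` one has `f z = c * exp (b z)`, which decays in the direction of
`-conj b`, and `G z = c z / (1 - b z)`, which is rational.
-/

open scoped ComplexConjugate

/-! ### Carlson's theorem -/

/-- The quotient `Q / S`, with the zeros of `S` filled in by l'Hôpital's rule. -/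
noncomputable def filledQuotient (Q S : ℂ → ℂ) (z : ℂ) : ℂ :=
  open Classical in if S z = 0 then deriv Q z / deriv S z else Q z / S z

lemma filledQuotient_of_ne_zero {Q S : ℂ → ℂ} {z : ℂ} (h : S z ≠ 0) :
    filledQuotient Q S z = Q z / S z := by
  simp [filledQuotient, h]

lemma differentiableAt_filledQuotient {Q S : ℂ → ℂ} (hQ : Differentiable ℂ Q)
    (hS : Differentiable ℂ S) {z₀ : ℂ} (h : S z₀ = 0 → Q z₀ = 0 ∧ deriv S z₀ ≠ 0) :
    DifferentiableAt ℂ (filledQuotient Q S) z₀ := by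
  by_cases h0 : S z₀ = 0
  · obtain ⟨hQ0, hS'⟩ := h h0
    have dd : ∀ {f : ℂ → ℂ}, Differentiable ℂ f → Differentiable ℂ (dslope f z₀) := fun hf =>
      differentiableOn_univ.1 ((Complex.differentiableOn_dslope univ_mem).2 hf.differentiableOn)
    have hne : ∀ᶠ z in 𝓝 z₀, dslope S z₀ z ≠ 0 :=
      (dd hS).continuous.continuousAt.eventually_ne (by rwa [dslope_same])
    have heq : filledQuotient Q S =ᶠ[𝓝 z₀] fun z => dslope Q z₀ z / dslope S z₀ z := by
      filter_upwards [hne] with z hz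
      by_cases hzz : z = z₀
      · subst hzz
        simp [filledQuotient, h0, dslope_same]
      · have h1 := sub_smul_dslope S z₀ z
        have h2 := sub_smul_dslope Q z₀ z
        rw [h0, sub_zero, smul_eq_mul] at h1
        rw [hQ0, sub_zero, smul_eq_mul] at h2
        have hsub := sub_ne_zero.2 hzz
        rw [filledQuotient_of_ne_zero (by rw [← h1]; exact mul_ne_zero hsub hz), ← h1, ← h2,
          mul_div_mul_left _ _ hsub]
    exact (((dd hQ) z₀).div ((dd hS) z₀) (by rwa [dslope_same])).congr_of_eventuallyEq heq
  · have heq : filledQuotient Q S =ᶠ[𝓝 z₀] fun z => Q z / S z := by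
      filter_upwards [hS.continuous.continuousAt.eventually_ne h0] with z hz
      exact filledQuotient_of_ne_zero hz
    exact ((hQ z₀).div (hS z₀) h0).congr_of_eventuallyEq heq

lemma norm_sq_sin (z : ℂ) : ‖Complex.sin z‖ ^ 2 = Real.sin z.re ^ 2 + Real.sinh z.im ^ 2 := by
  rw [← Complex.normSq_eq_norm_sq, Complex.sin_eq, Complex.normSq_apply]
  simp only [← Complex.ofReal_sin, ← Complex.ofReal_cos, ← Complex.ofReal_sinh,
    ← Complex.ofReal_cosh, Complex.add_re, Complex.add_im, Complex.mul_re, Complex.mul_im,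
    Complex.ofReal_re, Complex.ofReal_im, Complex.I_re, Complex.I_im]
  have h1 := Real.cosh_sq z.im
  have h2 := Real.sin_sq_add_cos_sq z.re
  linear_combination Real.sin z.re ^ 2 * h1 + Real.sinh z.im ^ 2 * h2

lemma exp_pi_div_four_le_norm_sin {z : ℂ} (hz : 1 ≤ |z.im|) :
    Real.exp (Real.pi * |z.im|) / 4 ≤ ‖Complex.sin (Real.pi * z)‖ := by
  have h0 : Real.sinh (Real.pi * |z.im|) ≤ ‖Complex.sin (Real.pi * z)‖ := by
    refine abs_le_of_sq_le_sq' ?_ (norm_nonneg _) |>.2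
    rw [norm_sq_sin]
    have : Real.sinh (Real.pi * |z.im|) ^ 2 = Real.sinh (((Real.pi : ℂ) * z).im) ^ 2 := by
      rw [Complex.im_ofReal_mul]
      rcases abs_cases z.im with ⟨h, -⟩ | ⟨h, -⟩ <;> rw [h]
      rw [mul_neg, Real.sinh_neg, neg_sq]
    rw [this]
    nlinarith [sq_nonneg (Real.sin (((Real.pi : ℂ) * z).re))]
  refine le_trans ?_ h0
  have ht : (1 : ℝ) ≤ Real.pi * |z.im| := by nlinarith [Real.pi_gt_three]
  rw [Real.sinh_eq]
  have h1 : (2 : ℝ) ≤ Real.exp (Real.pi * |z.im|) := by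
    linarith [Real.add_one_le_exp (Real.pi * |z.im|)]
  have h2 : Real.exp (-(Real.pi * |z.im|)) ≤ 1 := Real.exp_le_one_iff.2 (by linarith)
  linarith

lemma one_le_norm_sin_of_re {z : ℂ} {n : ℤ} (hz : z.re = n + 1 / 2) :
    1 ≤ ‖Complex.sin (Real.pi * z)‖ := by
  refine abs_le_of_sq_le_sq' ?_ (norm_nonneg _) |>.2
  rw [norm_sq_sin]
  have h1 : ((Real.pi : ℂ) * z).re = Real.pi / 2 + n * Real.pi := by
    simp [hz]; ring
  have : Real.sin (Real.pi / 2 + n * Real.pi) ^ 2 = 1 := by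
    have := Real.sin_sq_add_cos_sq (Real.pi / 2 + n * Real.pi)
    have h0 : Real.cos (Real.pi / 2 + n * Real.pi) = 0 := by
      rw [Real.cos_eq_zero_iff]; exact ⟨n, by ring⟩
    rw [h0] at this
    linarith
  rw [h1, this]
  nlinarith [sq_nonneg (Real.sinh (((Real.pi : ℂ) * z).im))]

/-- A function of exponential type in the right half-plane that decays exponentially in both
vertical directions vanishes. After multiplication by `exp (ω z)` it is bounded on the two rays on
which `(A + ω) Re z = κ |Im z|`, hence, by Phragmén–Lindelöf, in the sector between them, with a
bound that does not depend on `ω`. -/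
lemma eq_zero_of_decay_imag {g : ℂ → ℂ} {C A κ : ℝ} (hκ : 0 < κ)
    (hg : ∀ z : ℂ, 0 < z.re → DifferentiableAt ℂ g z)
    (hb : ∀ z : ℂ, 0 < z.re → ‖g z‖ ≤ C * Real.exp (A * z.re - κ * |z.im|)) {x : ℝ} (hx : 0 < x) :
    g x = 0 := by
  have hC : 0 ≤ C := by
    have := (norm_nonneg _).trans (hb 1 (by simp))
    exact nonneg_of_mul_nonneg_left this (Real.exp_pos _)
  have key : ∀ ω : ℝ, 0 < A + ω → ‖g x‖ ≤ C * Real.exp (-(ω * x)) := by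
    intro ω hω
    -- `α` is the argument of the ray on which `(A + ω) Re z = κ Im z`; the sector becomes a strip
    -- under `z = exp ζ`.
    set α := Real.arctan ((A + ω) / κ) with hα
    have hα0 : 0 < α := Real.arctan_pos.2 (by positivity)
    have hα1 : α < Real.pi / 2 := Real.arctan_lt_pi_div_two _
    have hcos : 0 < Real.cos α := Real.cos_arctan_pos _
    have htan : (A + ω) * Real.cos α = κ * Real.sin α := by
      have := Real.tan_arctan ((A + ω) / κ)
      rw [← hα, Real.tan_eq_sin_div_cos] at this
      field_simp at this
      linarith
    have hre : ∀ ζ : ℂ, |ζ.im| ≤ α → 0 < (Complex.exp ζ).re := by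
      intro ζ hζ
      rw [Complex.exp_re]
      have := abs_le.1 hζ
      exact mul_pos (Real.exp_pos _)
        (Real.cos_pos_of_mem_Ioo ⟨by linarith, by linarith⟩)
    set h : ℂ → ℂ := fun ζ => g (Complex.exp ζ) * Complex.exp (ω * Complex.exp ζ) with hh
    have hnorm : ∀ ζ : ℂ, |ζ.im| ≤ α → ‖h ζ‖ ≤ C * Real.exp ((A + ω) * (Complex.exp ζ).re
        - κ * |(Complex.exp ζ).im|) := by
      intro ζ hζ
      rw [hh, norm_mul, Complex.norm_exp, Complex.re_ofReal_mul]
      calc _ ≤ C * Real.exp (A * (Complex.exp ζ).re - κ * |(Complex.exp ζ).im|) *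
            Real.exp (ω * (Complex.exp ζ).re) := by
            gcongr; exact hb _ (hre ζ hζ)
        _ = _ := by rw [mul_assoc, ← Real.exp_add]; ring_nf
    have hedge : ∀ ζ : ℂ, |ζ.im| = α → ‖h ζ‖ ≤ C := by
      intro ζ hζ
      refine (hnorm ζ hζ.le).trans (mul_le_of_le_one_right hC (Real.exp_le_one_iff.2 ?_))
      rw [Complex.exp_re, Complex.exp_im, abs_mul, abs_of_pos (Real.exp_pos _),
        Real.abs_sin_eq_sin_abs_of_abs_le_pi (by rw [hζ]; linarith [Real.pi_pos]),
        ← Real.cos_abs ζ.im, hζ]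
      have : Real.exp ζ.re * ((A + ω) * Real.cos α - κ * Real.sin α) = 0 := by
        rw [htan, sub_self, mul_zero]
      linarith
    have hcl : closure (Complex.im ⁻¹' Set.Ioo (-α) α) ⊆ Complex.im ⁻¹' Set.Icc (-α) α :=
      closure_minimal (Set.preimage_mono Set.Ioo_subset_Icc_self)
        (isClosed_Icc.preimage Complex.continuous_im)
    have hd : DiffContOnCl ℂ h (Complex.im ⁻¹' Set.Ioo (-α) α) := by
      refine DifferentiableOn.diffContOnCl fun ζ hζ => ?_
      have hζ' := abs_le.2 (hcl hζ)
      have h1 : DifferentiableAt ℂ (fun ζ => g (Complex.exp ζ)) ζ :=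
        DifferentiableAt.comp ζ (hg _ (hre ζ hζ')) Complex.differentiableAt_exp
      exact (h1.mul (by fun_prop)).differentiableWithinAt
    have hlog : ‖h (Real.log x : ℂ)‖ ≤ C := by
      refine PhragmenLindelof.horizontal_strip hd ?_ (fun z hz => hedge z ?_)
        (fun z hz => hedge z ?_) ?_ ?_
      · refine ⟨1, ?_, A + ω, ?_⟩
        · rw [lt_div_iff₀ (by linarith)]
          linarith
        · refine Asymptotics.IsBigO.of_bound C ?_
          refine eventually_inf_principal.2 (Eventually.of_forall fun ζ hζ => ?_)
          refine (hnorm ζ (abs_le.2 ⟨hζ.1.le, hζ.2.le⟩)).trans ?_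
          rw [Real.norm_of_nonneg (Real.exp_pos _).le, one_mul]
          have : (Complex.exp ζ).re ≤ Real.exp |ζ.re| :=
            (Complex.re_le_norm _).trans (by rw [Complex.norm_exp]; gcongr; exact le_abs_self _)
          have h2 : 0 ≤ κ * |(Complex.exp ζ).im| := by positivity
          gcongr
          nlinarith
      · rw [hz, abs_neg, abs_of_pos hα0]
      · rw [hz, abs_of_pos hα0]
      · simp [hα0.le]
      · simp [hα0.le]
    have hexp : Complex.exp (Real.log x : ℂ) = x := by
      rw [← Complex.ofReal_exp, Real.exp_log hx]
    rw [hh] at hlog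
    simp only [hexp, norm_mul, Complex.norm_exp] at hlog
    rw [Complex.re_ofReal_mul, Complex.ofReal_re] at hlog
    rw [Real.exp_neg, ← div_eq_mul_inv, le_div_iff₀ (Real.exp_pos _)]
    exact hlog
  have hlim : Tendsto (fun ω : ℝ => C * Real.exp (-(ω * x))) atTop (𝓝 (C * 0)) :=
    (Real.tendsto_exp_neg_atTop_nhds_zero.comp (tendsto_id.atTop_mul_const hx)).const_mul C
  rw [mul_zero] at hlim
  have : ‖g x‖ ≤ 0 := ge_of_tendsto hlim (by
    filter_upwards [eventually_gt_atTop (-A)] with ω hω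
    exact key ω (by linarith))
  exact norm_le_zero_iff.1 this

/-- **Carlson's theorem**, for entire functions: the growth bound makes `Q z / sin (π z)` decay
exponentially in the vertical directions, uniformly up to a factor `exp (A Re z)`. -/
theorem carlson {Q : ℂ → ℂ} (hQ : Differentiable ℂ Q) {C A γ : ℝ} (hA : 0 ≤ A) (hγ : 0 ≤ γ)
    (hγπ : γ < Real.pi) (hb : ∀ z : ℂ, ‖Q z‖ ≤ C * Real.exp (A * |z.re| + γ * |z.im|))
    (h0 : ∀ n : ℕ, Q n = 0) : Q = 0 := by
  have hC : 0 ≤ C :=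
    nonneg_of_mul_nonneg_left ((norm_nonneg _).trans (hb 0)) (Real.exp_pos _)
  set S : ℂ → ℂ := fun z => Complex.sin (Real.pi * z) with hSdef
  have hS : Differentiable ℂ S := by fun_prop
  have hS' : ∀ z, deriv S z = Real.pi * Complex.cos (Real.pi * z) := by
    intro z
    have h1 : HasDerivAt (fun z : ℂ => (Real.pi : ℂ) * z) (Real.pi * 1) z :=
      (hasDerivAt_id z).const_mul _
    rw [h1.csin.deriv]; ring
  set g := filledQuotient Q S with hgdef
  have hgd : ∀ z : ℂ, -1 < z.re → DifferentiableAt ℂ g z := by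
    intro z hz
    refine differentiableAt_filledQuotient hQ hS fun hSz => ⟨?_, ?_⟩
    · obtain ⟨k, hk⟩ := Complex.sin_eq_zero_iff.1 hSz
      have hzk : z = k := by
        rw [mul_comm] at hk
        exact mul_right_cancel₀ (Complex.ofReal_ne_zero.2 Real.pi_ne_zero) hk
      have hk0 : 0 ≤ k := by
        rw [hzk, Complex.intCast_re] at hz
        have : (-1 : ℤ) < k := by exact_mod_cast hz
        omega
      lift k to ℕ using hk0
      rw [hzk]
      exact_mod_cast h0 k
    · rw [hS']
      refine mul_ne_zero (Complex.ofReal_ne_zero.2 Real.pi_ne_zero) fun hc => ?_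
      have := Complex.sin_sq_add_cos_sq (Real.pi * z)
      rw [hc, show Complex.sin (Real.pi * z) = 0 from hSz] at this
      norm_num at this
  have hquot : ∀ {z : ℂ} {m : ℝ}, 0 < m → m ≤ ‖S z‖ → ‖g z‖ ≤ ‖Q z‖ / m := by
    intro z m hm hmz
    rw [hgdef, filledQuotient_of_ne_zero (norm_pos_iff.1 (hm.trans_le hmz)), norm_div]
    gcongr
  -- far from the real axis
  have hfar : ∀ z : ℂ, 0 ≤ z.re → 1 ≤ |z.im| →
      ‖g z‖ ≤ 4 * C * Real.exp (A * z.re - (Real.pi - γ) * |z.im|) := by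
    intro z hz hz'
    refine (hquot (by positivity) (exp_pi_div_four_le_norm_sin hz')).trans ?_
    rw [div_le_iff₀ (by positivity)]
    refine (hb z).trans (le_of_eq ?_)
    rw [abs_of_nonneg hz, show A * z.re + γ * |z.im| =
      (A * z.re - (Real.pi - γ) * |z.im|) + Real.pi * |z.im| by ring, Real.exp_add]
    ring
  -- near the real axis, by the maximum principle on a rectangle around an integer
  have hnear : ∀ z : ℂ, 0 ≤ z.re → |z.im| ≤ 1 → ‖g z‖ ≤ C * Real.exp (A * (z.re + 1) + γ) := by
    intro z hz hz'
    set n := round z.re with hn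
    have hn1 := abs_le.1 (abs_sub_round z.re)
    rw [← hn] at hn1
    have hn0 : (0 : ℝ) ≤ n := by
      have : (-1 : ℤ) < n := by
        have : (-1 : ℝ) < n := by linarith
        exact_mod_cast this
      exact_mod_cast (show (0 : ℤ) ≤ n by omega)
    set U : Set ℂ := Set.Ioo ((n : ℝ) - 1 / 2) (n + 1 / 2) ×ℂ Set.Ioo (-1 : ℝ) 1 with hU
    have hcl : closure U = Set.Icc ((n : ℝ) - 1 / 2) (n + 1 / 2) ×ℂ Set.Icc (-1 : ℝ) 1 := by
      rw [hU, Complex.closure_reProdIm, closure_Ioo (by linarith), closure_Ioo (by norm_num)]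
    have hbd : Bornology.IsBounded U :=
      (Metric.isBounded_Ioo _ _).reProdIm (Metric.isBounded_Ioo _ _)
    have hdU : DiffContOnCl ℂ g U := by
      refine DifferentiableOn.diffContOnCl fun ζ hζ => (hgd ζ ?_).differentiableWithinAt
      rw [hcl] at hζ
      have := hζ.1.1
      linarith
    refine Complex.norm_le_of_forall_mem_frontier_norm_le hbd hdU (fun ζ hζ => ?_) ?_
    · have hζc : ζ ∈ closure U := frontier_subset_closure hζ
      rw [hcl] at hζc
      have hre : |ζ.re| ≤ z.re + 1 := by
        have h1 := hζc.1.1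
        have h2 := hζc.1.2
        rw [abs_le]; constructor <;> linarith
      have him : |ζ.im| ≤ 1 := abs_le.2 hζc.2
      have hone : 1 ≤ ‖S ζ‖ := by
        rw [hU, Complex.frontier_reProdIm, frontier_Ioo (a := (n : ℝ) - 1 / 2) (by linarith),
          frontier_Ioo (by norm_num)] at hζ
        rcases hζ with hζ | hζ
        · have h1 : |ζ.im| = 1 := by
            rcases hζ.2 with h | h
            · rw [h]; norm_num
            · rw [Set.mem_singleton_iff.1 h]; norm_num
          have := exp_pi_div_four_le_norm_sin (z := ζ) h1.ge
          rw [h1, mul_one] at this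
          have h4 : (4 : ℝ) ≤ Real.exp Real.pi := by
            linarith [Real.add_one_le_exp Real.pi, Real.pi_gt_three]
          refine le_trans ?_ this
          linarith
        · rcases hζ.1 with h | h
          · refine one_le_norm_sin_of_re (n := n - 1) ?_
            rw [h]; push_cast; ring
          · exact one_le_norm_sin_of_re (n := n) h
      refine (hquot one_pos hone).trans ?_
      rw [div_one]
      refine (hb ζ).trans ?_
      have h5 : γ * |ζ.im| ≤ γ := mul_le_of_le_one_right hγ him
      gcongr
    · rw [hcl]
      exact ⟨⟨by linarith, by linarith⟩, abs_le.1 hz'⟩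
  have hall : ∀ z : ℂ, 0 < z.re → ‖g z‖ ≤ 4 * C * Real.exp (A + Real.pi) *
      Real.exp (A * z.re - (Real.pi - γ) * |z.im|) := by
    intro z hz
    rcases le_total 1 |z.im| with h | h
    · refine (hfar z hz.le h).trans ?_
      exact mul_le_mul_of_nonneg_right (le_mul_of_one_le_right (by positivity)
        (Real.one_le_exp (by linarith [Real.pi_pos]))) (Real.exp_pos _).le
    · refine (hnear z hz.le h).trans ?_
      rw [mul_assoc, ← Real.exp_add]
      have h6 : (Real.pi - γ) * |z.im| ≤ Real.pi - γ :=
        mul_le_of_le_one_right (by linarith) h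
      calc C * Real.exp (A * (z.re + 1) + γ)
          ≤ 4 * C * Real.exp (A * (z.re + 1) + γ) := by
            gcongr; linarith
        _ ≤ _ := mul_le_mul_of_nonneg_left (Real.exp_le_exp.2 (by linarith)) (by positivity)
  have hzero : ∀ x : ℝ, 0 < x → Q x = 0 := by
    intro x hx
    have hgx : g x = 0 := eq_zero_of_decay_imag (sub_pos.2 hγπ)
      (fun z hz => hgd z (by linarith)) hall hx
    by_cases hSx : S x = 0
    · obtain ⟨k, hk⟩ := Complex.sin_eq_zero_iff.1 hSx
      have hxk : x = k := by
        rw [mul_comm] at hk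
        exact_mod_cast mul_right_cancel₀ (Complex.ofReal_ne_zero.2 Real.pi_ne_zero) hk
      have hk0 : 0 ≤ k := by
        rw [hxk] at hx; exact_mod_cast hx.le
      lift k to ℕ using hk0
      rw [hxk]
      exact_mod_cast h0 k
    · rw [hgdef, filledQuotient_of_ne_zero hSx] at hgx
      exact (div_eq_zero_iff.1 hgx).resolve_right hSx
  have hfreq : ∃ᶠ z in 𝓝[≠] (1 : ℂ), Q z = 0 := by
    have ht : Tendsto (fun x : ℝ => (x : ℂ)) (𝓝[≠] 1) (𝓝[≠] 1) := by
      refine tendsto_nhdsWithin_iff.2 ⟨?_, ?_⟩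
      · exact (Complex.continuous_ofReal.tendsto' 1 1 (by simp)).mono_left nhdsWithin_le_nhds
      · filter_upwards [self_mem_nhdsWithin] with x hx
        simpa using hx
    refine ht.frequently (Eventually.frequently ?_)
    filter_upwards [nhdsWithin_le_nhds (lt_mem_nhds (zero_lt_one' ℝ))] with x hx
    exact hzero x hx
  have han : AnalyticOnNhd ℂ Q Set.univ := fun z _ => hQ.analyticAt z
  funext z
  exact han.eqOn_zero_of_preconnected_of_frequently_eq_zero isPreconnected_univ
    (Set.mem_univ 1) hfreq (Set.mem_univ z)

/-! ### Zero-free entire functions of exponential type -/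

/-- An entire function of at most linear growth is affine. -/
lemma exists_affine_of_linear_growth {L : ℂ → ℂ} (hL : Differentiable ℂ L) {K : ℝ}
    (hb : ∀ z, ‖L z‖ ≤ K * (‖z‖ + 1)) : ∃ α : ℂ, ∀ z, L z = α * z + L 0 := by
  have hK : 0 ≤ K := nonneg_of_mul_nonneg_left ((norm_nonneg _).trans (hb 0)) (by simp)
  have hder : ∀ z, ‖deriv L z‖ ≤ 2 * K := by
    intro z
    have hpos : 0 < ‖z‖ + 1 := by positivity
    have := Complex.norm_deriv_le_of_forall_mem_sphere_norm_le (f := L) (c := z) hpos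
      (C := 2 * K * (‖z‖ + 1)) hL.diffContOnCl (fun w hw => by
        refine (hb w).trans ?_
        have h1 : ‖w‖ ≤ ‖z‖ + (‖z‖ + 1) := by
          have := norm_le_norm_add_norm_sub' w z
          rwa [mem_sphere_iff_norm.1 hw] at this
        nlinarith)
    rwa [mul_div_cancel_right₀ _ hpos.ne'] at this
  have hd : Differentiable ℂ (deriv L) := fun z =>
    (hL.analyticAt z).deriv.differentiableAt
  obtain ⟨α, hα⟩ := hd.exists_const_forall_eq_of_bounded
    (isBounded_iff_forall_norm_le.2 ⟨2 * K, by rintro _ ⟨z, rfl⟩; exact hder z⟩)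
  refine ⟨α, fun z => ?_⟩
  have hM : Differentiable ℂ fun z => L z - α * z := by fun_prop
  have hM' : ∀ z, deriv (fun z => L z - α * z) z = 0 := by
    intro z
    have h1 : HasDerivAt (fun z => L z - α * z) (deriv L z - α * 1) z :=
      (hL z).hasDerivAt.sub ((hasDerivAt_id z).const_mul α)
    rw [h1.deriv, hα, mul_one, sub_self]
  have := is_const_of_deriv_eq_zero hM hM' z 0
  simp only [mul_zero, sub_zero] at this
  linear_combination this

/-- A zero-free entire function of exponential type is the exponential of an affine function. -/
theorem exists_exp_affine_of_ne_zero {F : ℂ → ℂ} (hF : Differentiable ℂ F) (h0 : ∀ z, F z ≠ 0)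
    {C A : ℝ} (hb : ∀ z, ‖F z‖ ≤ C * Real.exp (A * ‖z‖)) :
    ∃ α : ℂ, ∀ z, F z = F 0 * Complex.exp (α * z) := by
  have hdF : Differentiable ℂ (deriv F) := fun z => (hF.analyticAt z).deriv.differentiableAt
  obtain ⟨L₀, hL₀⟩ := (hdF.div hF h0).isExactOn_univ
  set L : ℂ → ℂ := fun z => L₀ z - L₀ 0 with hLdef
  have hL : ∀ z, HasDerivAt L (deriv F z / F z) z := fun z => (hL₀ z trivial).sub_const _
  have hLd : Differentiable ℂ L := fun z => (hL z).differentiableAt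
  have hL0 : L 0 = 0 := sub_self _
  have hexp : ∀ z, F z = F 0 * Complex.exp (L z) := by
    have hder : ∀ z, HasDerivAt (fun z => F z * Complex.exp (-L z)) 0 z := by
      intro z
      refine ((hF z).hasDerivAt.mul (hL z).neg.cexp).congr_deriv ?_
      have := h0 z
      field_simp
      ring
    intro z
    have := is_const_of_deriv_eq_zero (fun z => (hder z).differentiableAt)
      (fun z => (hder z).deriv) z 0
    rw [hL0, neg_zero, Complex.exp_zero, mul_one, Complex.exp_neg] at this
    field_simp at this
    rw [this]; ring
  have hC : 0 < C := by
    have := (norm_pos_iff.2 (h0 0)).trans_le (hb 0)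
    exact pos_of_mul_pos_left this (Real.exp_pos _).le
  have hF0 := norm_pos_iff.2 (h0 0)
  set M : ℝ := |Real.log (C / ‖F 0‖)| + 1 + |A| with hM
  have hre : ∀ z, (L z).re ≤ M * (‖z‖ + 1) := by
    intro z
    have h1 := hb z
    rw [hexp z, norm_mul, Complex.norm_exp, mul_comm, ← le_div_iff₀ hF0] at h1
    have h2 := Real.log_le_log (Real.exp_pos _) h1
    rw [Real.log_exp, mul_div_right_comm, Real.log_mul (by positivity) (Real.exp_pos _).ne',
      Real.log_exp] at h2
    have h3 := le_abs_self (Real.log (C / ‖F 0‖))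
    have h4 : A * ‖z‖ ≤ |A| * ‖z‖ := by gcongr; exact le_abs_self A
    have h5 : 0 ≤ |Real.log (C / ‖F 0‖)| * ‖z‖ := by positivity
    have h6 : 0 ≤ |A| := by positivity
    have h7 : 0 ≤ ‖z‖ := norm_nonneg z
    rw [hM]
    nlinarith
  have hMpos : 0 < M := by positivity
  have hLb : ∀ z, ‖L z‖ ≤ 4 * M * (‖z‖ + 1) := by
    intro z
    have hR : 0 < 2 * ‖z‖ + 1 := by positivity
    have hz : z ∈ Metric.ball (0 : ℂ) (2 * ‖z‖ + 1) := by
      rw [mem_ball_zero_iff]; linarith [norm_nonneg z]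
    have := Complex.borelCaratheodory_zero (M := M * (2 * ‖z‖ + 1 + 1)) (by positivity)
      hLd.differentiableOn (fun w hw => by
        rw [mem_ball_zero_iff] at hw
        refine (hre w).trans ?_
        gcongr) hR hz hL0
    refine this.trans ?_
    rw [div_le_iff₀ (by linarith [norm_nonneg z])]
    nlinarith [norm_nonneg z, mul_nonneg hMpos.le (norm_nonneg z)]
  obtain ⟨α, hα⟩ := exists_affine_of_linear_growth hLd hLb
  refine ⟨α, fun z => ?_⟩
  rw [hexp z, hα z, hL0, add_zero]

/-! ### Interpolation of the coefficients by an entire function -/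

/-- The moment of order `z` of `B` on the circle with centre `c` and radius `r`, for the principal
branch of `w ^ z`. It is only used for circles in the right half-plane. -/
noncomputable def circleMoment (B : ℂ → ℂ) (c r : ℝ) (z : ℂ) : ℂ :=
  (2 * Real.pi * Complex.I)⁻¹ • ∮ w in C((c : ℂ), r), B w * w ^ z

lemma re_pos_of_mem_sphere {c r : ℝ} (hrc : r < c) {w : ℂ} (hw : w ∈ Metric.sphere (c : ℂ) r) :
    0 < w.re := by
  have h1 : ‖w - c‖ = r := mem_sphere_iff_norm.1 hw
  have h2 := (abs_le.1 (Complex.abs_re_le_norm (w - c))).1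
  rw [Complex.sub_re, Complex.ofReal_re, h1] at h2
  linarith

lemma exists_norm_log_le {c r : ℝ} (hrc : r < c) :
    ∃ Λ, 0 ≤ Λ ∧ ∀ w ∈ Metric.sphere (c : ℂ) r, ‖Complex.log w‖ ≤ Λ := by
  obtain ⟨Λ, hΛ⟩ := (isCompact_sphere (c : ℂ) r).exists_bound_of_continuousOn
    (f := Complex.log) (continuousOn_id.clog fun w hw => Or.inl (re_pos_of_mem_sphere hrc hw))
  exact ⟨|Λ|, abs_nonneg _, fun w hw => (hΛ w hw).trans (le_abs_self _)⟩

lemma differentiable_circleMoment {B : ℂ → ℂ} {c r : ℝ} (hr : 0 ≤ r) (hrc : r < c)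
    (hB : ContinuousOn B (Metric.sphere (c : ℂ) r)) : Differentiable ℂ (circleMoment B c r) := by
  obtain ⟨Λ, hΛ0, hΛ⟩ := exists_norm_log_le hrc
  obtain ⟨M, hM⟩ := (isCompact_sphere (c : ℂ) r).exists_bound_of_continuousOn hB
  have hcm : ∀ θ, circleMap (c : ℂ) r θ ∈ Metric.sphere (c : ℂ) r := circleMap_mem_sphere _ hr
  have hslit : ∀ θ, circleMap (c : ℂ) r θ ∈ Complex.slitPlane := fun θ =>
    Or.inl (re_pos_of_mem_sphere hrc (hcm θ))
  have hne : ∀ θ, circleMap (c : ℂ) r θ ≠ 0 := fun θ => Complex.slitPlane_ne_zero (hslit θ)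
  have hBc : Continuous fun θ => B (circleMap (c : ℂ) r θ) :=
    hB.comp_continuous (continuous_circleMap _ _) hcm
  have hdc : Continuous (deriv (circleMap (c : ℂ) r)) := by
    rw [funext (deriv_circleMap _ _)]; fun_prop
  have hpow : ∀ z : ℂ, Continuous fun θ => circleMap (c : ℂ) r θ ^ z := fun z =>
    (continuous_circleMap _ _).cpow continuous_const hslit
  have hlog : Continuous fun θ => Complex.log (circleMap (c : ℂ) r θ) :=
    (continuous_circleMap _ _).clog hslit
  have hpownorm : ∀ (z : ℂ) θ, ‖circleMap (c : ℂ) r θ ^ z‖ ≤ Real.exp (Λ * ‖z‖) := by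
    intro z θ
    rw [Complex.cpow_def_of_ne_zero (hne θ)]
    refine (Complex.norm_exp_le_exp_norm _).trans ?_
    rw [norm_mul]
    gcongr
    exact hΛ _ (hcm θ)
  intro z₀
  suffices h : HasDerivAt (fun z => ∮ w in C((c : ℂ), r), B w * w ^ z)
      (∫ θ in (0)..2 * Real.pi, deriv (circleMap (c : ℂ) r) θ •
        (B (circleMap (c : ℂ) r θ) *
          (circleMap (c : ℂ) r θ ^ z₀ * Complex.log (circleMap (c : ℂ) r θ)))) z₀ from
    h.differentiableAt.const_smul (2 * Real.pi * Complex.I : ℂ)⁻¹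
  refine (intervalIntegral.hasDerivAt_integral_of_dominated_loc_of_deriv_le
    (F := fun z θ => deriv (circleMap (c : ℂ) r) θ •
      (B (circleMap (c : ℂ) r θ) * circleMap (c : ℂ) r θ ^ z))
    (F' := fun z θ => deriv (circleMap (c : ℂ) r) θ •
      (B (circleMap (c : ℂ) r θ) *
        (circleMap (c : ℂ) r θ ^ z * Complex.log (circleMap (c : ℂ) r θ))))
    (bound := fun _ => r * (M * (Real.exp (Λ * (‖z₀‖ + 1)) * Λ)))
    (Metric.ball_mem_nhds z₀ one_pos) ?_ ?_ ?_ ?_ ?_ ?_).2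
  · refine Eventually.of_forall fun z => Continuous.aestronglyMeasurable ?_
    exact hdc.smul (hBc.mul (hpow z))
  · exact (hdc.smul (hBc.mul (hpow z₀))).intervalIntegrable _ _
  · exact (hdc.smul (hBc.mul ((hpow z₀).mul hlog))).aestronglyMeasurable
  · refine Eventually.of_forall fun θ _ z hz => ?_
    have hz' : ‖z‖ ≤ ‖z₀‖ + 1 := by
      have := norm_le_norm_add_norm_sub' z z₀
      rw [mem_ball_iff_norm] at hz
      linarith
    rw [norm_smul, norm_mul, norm_mul, deriv_circleMap, norm_mul, norm_circleMap_zero,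
      Complex.norm_I, mul_one, abs_of_nonneg hr]
    have hM0 : 0 ≤ M := (norm_nonneg _).trans (hM _ (hcm θ))
    gcongr
    · exact hM _ (hcm θ)
    · exact (hpownorm z θ).trans (by gcongr)
    · exact hΛ _ (hcm θ)
  · exact intervalIntegrable_const
  · refine Eventually.of_forall fun θ _ z _ => ?_
    have h1 : HasDerivAt (fun z => circleMap (c : ℂ) r θ ^ z)
        (circleMap (c : ℂ) r θ ^ z * Complex.log (circleMap (c : ℂ) r θ)) z := by
      simpa using (hasDerivAt_id z).const_cpow (c := circleMap (c : ℂ) r θ) (Or.inl (hne θ))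
    exact (h1.const_mul (B (circleMap (c : ℂ) r θ))).const_smul (deriv (circleMap (c : ℂ) r) θ)

/-- A circle in the right half-plane is seen from the origin under an angle `2 β < π`, so its
moments grow in the vertical directions with type less than `π / 2`. -/
lemma exists_norm_circleMoment_le {B : ℂ → ℂ} {c r : ℝ} (hr : 0 ≤ r) (hrc : r < c)
    (hB : ContinuousOn B (Metric.sphere (c : ℂ) r)) :
    ∃ C A β : ℝ, 0 ≤ A ∧ 0 ≤ β ∧ β < Real.pi / 2 ∧
      ∀ z, ‖circleMoment B c r z‖ ≤ C * Real.exp (A * |z.re| + β * |z.im|) := by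
  obtain ⟨Λ, hΛ0, hΛ⟩ := exists_norm_log_le hrc
  obtain ⟨M, hM⟩ := (isCompact_sphere (c : ℂ) r).exists_bound_of_continuousOn hB
  have hargc : ContinuousOn (fun w => |Complex.arg w|) (Metric.sphere (c : ℂ) r) := fun w hw =>
    (Complex.continuousAt_arg (Or.inl (re_pos_of_mem_sphere hrc hw))).abs.continuousWithinAt
  have hnemp : (Metric.sphere (c : ℂ) r).Nonempty := NormedSpace.sphere_nonempty.2 hr
  obtain ⟨w₀, hw₀, hmax⟩ := (isCompact_sphere (c : ℂ) r).exists_isMaxOn hnemp hargc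
  refine ⟨r * M, Λ, |Complex.arg w₀|, hΛ0, abs_nonneg _,
    Complex.abs_arg_lt_pi_div_two_iff.2 (Or.inl (re_pos_of_mem_sphere hrc hw₀)), fun z => ?_⟩
  rw [mul_assoc]
  refine circleIntegral.norm_two_pi_i_inv_smul_integral_le_of_norm_le_const hr fun w hw => ?_
  have hwne : w ≠ 0 := fun h => by
    have := re_pos_of_mem_sphere hrc hw
    simp [h] at this
  have hM0 : 0 ≤ M := (norm_nonneg _).trans (hM _ hw)
  rw [norm_mul, Complex.cpow_def_of_ne_zero hwne, Complex.norm_exp, Complex.mul_re,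
    Complex.log_im]
  have h1 : (Complex.log w).re * z.re ≤ Λ * |z.re| := by
    refine (le_abs_self _).trans ?_
    rw [abs_mul]
    gcongr
    exact (Complex.abs_re_le_norm _).trans (hΛ w hw)
  have h2 : -(w.arg * z.im) ≤ |w₀.arg| * |z.im| := by
    refine (neg_le_abs _).trans ?_
    rw [abs_mul]
    exact mul_le_mul_of_nonneg_right (hmax hw) (abs_nonneg _)
  gcongr
  · exact hM w hw
  · linarith

/-- If `B w = ∑ aₙ / w ^ (n + 1)` near infinity and `B` is holomorphic outside the circle, the
moment of order `n` is the residue at infinity of `B w * w ^ n`, that is `aₙ`. -/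
lemma circleMoment_natCast {a : ℕ → ℂ} (ha : ∀ n, ‖a n‖ ≤ 1) {B : ℂ → ℂ} {c r R₀ : ℝ}
    (hr : 0 < r) (hrc : r < c) (hR₀ : 1 ≤ R₀)
    (hB : ∀ w : ℂ, r ≤ ‖w - c‖ → DifferentiableAt ℂ B w)
    (hBs : ∀ w : ℂ, R₀ < ‖w‖ → B w = ∑' n, a n * w⁻¹ ^ (n + 1)) (n : ℕ) :
    circleMoment B c r n = a n := by
  set R : ℝ := c + R₀ + 1 with hR
  have hR0 : 0 < R := by linarith
  have hcR : ((c : ℂ) - 0) ∈ Metric.ball (0 : ℂ) R := by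
    rw [sub_zero, mem_ball_zero_iff, Complex.norm_of_nonneg (by linarith)]
    linarith
  have hlarge : ∀ w ∈ Metric.sphere (c : ℂ) R, R₀ + 1 ≤ ‖w‖ := by
    intro w hw
    have h1 : ‖w - c‖ = R := mem_sphere_iff_norm.1 hw
    have h2 := norm_sub_le w c
    rw [h1, Complex.norm_of_nonneg (by linarith)] at h2
    linarith
  have hchange : (∮ w in C((c : ℂ), R), B w * w ^ (n : ℂ)) =
      ∮ w in C((c : ℂ), r), B w * w ^ (n : ℂ) := by
    have hd : ∀ w : ℂ, r ≤ ‖w - c‖ → DifferentiableAt ℂ (fun w => B w * w ^ (n : ℂ)) w := by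
      intro w hw
      simp only [Complex.cpow_natCast]
      exact (hB w hw).mul (by fun_prop)
    refine Complex.circleIntegral_eq_of_differentiable_on_annulus_off_countable hr
      (by linarith) Set.countable_empty (fun w hw => ?_) (fun w hw => hd w ?_)
    · refine (hd w ?_).continuousAt.continuousWithinAt
      simpa [dist_eq_norm] using hw.2
    · have := hw.1.2
      rw [Metric.mem_closedBall, dist_eq_norm, not_le] at this
      exact this.le
  set term : ℕ → ℂ → ℂ := fun k w => a k * w ^ ((n : ℤ) - (k + 1)) with hterm
  have hne : ∀ w ∈ Metric.sphere (c : ℂ) R, w ≠ 0 := fun w hw => by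
    rw [← norm_pos_iff]
    linarith [hlarge w hw]
  have hser : Set.EqOn (fun w => B w * w ^ (n : ℂ)) (fun w => ∑' k, term k w)
      (Metric.sphere (c : ℂ) R) := by
    intro w hw
    have hw0 := hne w hw
    simp only [hterm]
    rw [hBs w (by linarith [hlarge w hw]), ← tsum_mul_right]
    refine tsum_congr fun k => ?_
    rw [Complex.cpow_natCast, zpow_sub₀ hw0, zpow_natCast]
    norm_cast
    rw [inv_pow]
    field_simp
  have hcont : ∀ k, ContinuousOn (term k) (Metric.sphere (c : ℂ) R) := fun k =>
    continuousOn_const.mul (continuousOn_id.zpow₀ _ fun w hw => Or.inl (hne w hw))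
  have hgeo : Summable fun k : ℕ => (‖(c : ℂ)‖ + R) ^ n * ((R₀ + 1)⁻¹ ^ (k + 1)) := by
    refine Summable.mul_left _ ((summable_nat_add_iff 1).2 ?_)
    exact summable_geometric_of_lt_one (by positivity)
      (inv_lt_one_of_one_lt₀ (by linarith))
  have hunif := tendstoUniformlyOn_tsum_nat hgeo (f := term) (s := Metric.sphere (c : ℂ) R)
    (fun k w hw => by
      have hw0 := hne w hw
      have h1 : ‖w - c‖ = R := mem_sphere_iff_norm.1 hw
      have h2 : ‖w‖ ≤ ‖(c : ℂ)‖ + R := by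
        rw [← h1]; exact norm_le_norm_add_norm_sub' _ _
      rw [hterm, norm_mul, norm_zpow, zpow_sub₀ (norm_ne_zero_iff.2 hw0), zpow_natCast,
        div_eq_mul_inv, show (k : ℤ) + 1 = ((k + 1 : ℕ) : ℤ) by push_cast; rfl, zpow_natCast,
        ← inv_pow]
      calc ‖a k‖ * (‖w‖ ^ n * ‖w‖⁻¹ ^ (k + 1))
          ≤ 1 * ((‖(c : ℂ)‖ + R) ^ n * (R₀ + 1)⁻¹ ^ (k + 1)) := by
            have := hlarge w hw
            gcongr
            exact ha k
        _ = _ := one_mul _)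
  have hlim := hunif.tendsto_circleIntegral_of_continuousOn hR0.le
    (Eventually.of_forall fun N => continuousOn_finsetSum _ fun k _ => hcont k)
  have hval : ∀ k, (∮ w in C((c : ℂ), R), term k w) =
      if k = n then 2 * Real.pi * Complex.I * a n else 0 := by
    intro k
    rw [hterm, circleIntegral.integral_const_mul]
    split_ifs with hk
    · subst hk
      have := circleIntegral.integral_sub_inv_of_mem_ball (c := (c : ℂ)) (w := 0) (R := R)
        (by rw [Metric.mem_ball, dist_comm]; simpa using hcR)
      simp only [sub_zero] at this
      have h2 : (k : ℤ) - (k + 1) = -1 := by ring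
      simp only [h2, zpow_neg_one]
      rw [this]; ring
    · have := circleIntegral.integral_sub_zpow_of_ne (n := (n : ℤ) - (k + 1)) (by omega)
        (c : ℂ) 0 R
      simp only [sub_zero] at this
      rw [this, mul_zero]
  have hconst : ∀ᶠ N in atTop, (∮ w in C((c : ℂ), R), ∑ k ∈ Finset.range N, term k w) =
      2 * Real.pi * Complex.I * a n := by
    filter_upwards [eventually_gt_atTop n] with N hN
    rw [circleIntegral.integral_fun_sum fun k _ => (hcont k).circleIntegrable hR0.le]
    simp [hval, hN]
  have hfin := tendsto_nhds_unique (hlim.congr' hconst) tendsto_const_nhds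
  rw [circleMoment, ← hchange, circleIntegral.integral_congr hR0.le hser, hfin, smul_eq_mul,
    inv_mul_cancel_left₀ Complex.two_pi_I_ne_zero]

lemma norm_eq_one_of_geometric {a : ℕ → ℂ} (ha : ∀ n, ‖a n‖ = 1) {c b : ℂ}
    (h : ∀ n, a n = c * b ^ n) : ‖c‖ = 1 ∧ ‖b‖ = 1 := by
  have hc : ‖c‖ = 1 := by simpa [ha 0] using (congrArg norm (h 0)).symm
  have h1 := congrArg norm (h 1)
  rw [ha 1, norm_mul, hc, one_mul, pow_one] at h1
  exact ⟨hc, h1.symm⟩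

/-- An entire function `F` that is unimodular at the natural numbers and whose vertical type is less
than `π / 2` satisfies `F z * conj (F (conj z)) = 1` by Carlson's theorem, so it has no zeros. -/
lemma exists_exp_of_unimodular {F : ℂ → ℂ} (hF : Differentiable ℂ F) {C A β : ℝ} (hA : 0 ≤ A)
    (hβ : 0 ≤ β) (hβπ : β < Real.pi / 2)
    (hb : ∀ z : ℂ, ‖F z‖ ≤ C * Real.exp (A * |z.re| + β * |z.im|))
    (h1 : ∀ n : ℕ, ‖F n‖ = 1) : ∃ α : ℂ, ∀ z, F z = F 0 * Complex.exp (α * z) := by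
  have hC : 0 ≤ C :=
    nonneg_of_mul_nonneg_left ((norm_nonneg _).trans (hb 0)) (Real.exp_pos _)
  set Q : ℂ → ℂ := fun z => F z * conj (F (conj z)) - 1 with hQdef
  have hQ : Differentiable ℂ Q := by
    intro z
    refine ((hF z).mul ?_).sub_const _
    simpa [Function.comp_def] using (hF (conj z)).conj_conj
  have hQ0 : Q = 0 := by
    refine carlson hQ (C := C ^ 2 + 1) (A := 2 * A) (γ := 2 * β) (by positivity) (by positivity)
      (by linarith) (fun z => ?_) fun n => ?_
    · refine (norm_sub_le _ _).trans ?_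
      rw [norm_mul, RCLike.norm_conj, norm_one, add_mul, one_mul]
      have h2 := hb (conj z)
      rw [Complex.conj_re, Complex.conj_im, abs_neg] at h2
      have h3 : C ^ 2 * Real.exp (2 * A * |z.re| + 2 * β * |z.im|) =
          (C * Real.exp (A * |z.re| + β * |z.im|)) *
            (C * Real.exp (A * |z.re| + β * |z.im|)) := by
        rw [mul_mul_mul_comm, ← Real.exp_add]; ring_nf
      rw [h3]
      gcongr
      · exact hb z
      · exact Real.one_le_exp (by positivity)
    · simp only [hQdef, Complex.conj_natCast, Complex.mul_conj, Complex.normSq_eq_norm_sq, h1]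
      simp
  have hne : ∀ z, F z ≠ 0 := by
    intro z hz
    have := congrFun hQ0 z
    simp [hQdef, hz] at this
  refine exists_exp_affine_of_ne_zero hF hne (C := C) (A := A + β) fun z => (hb z).trans ?_
  have h1 := Complex.abs_re_le_norm z
  have h2 := Complex.abs_im_le_norm z
  gcongr
  nlinarith

/-- If the Borel transform `∑ aₙ / w ^ (n + 1)` of a unimodular sequence continues to a half-plane
`Re w < δ` with `δ > 0`, its singularities lie inside a circle in the right half-plane, and the
moments on that circle interpolate `aₙ`. -/
theorem isUnimodularGeometric_of_continuation {a : ℕ → ℂ} (ha : ∀ n, ‖a n‖ = 1) {δ R₀ : ℝ}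
    (hδ : 0 < δ) (hR₀ : 1 ≤ R₀) {B : ℂ → ℂ}
    (hB : ∀ w : ℂ, w.re < δ ∨ R₀ < ‖w‖ → DifferentiableAt ℂ B w)
    (hBs : ∀ w : ℂ, R₀ < ‖w‖ → B w = ∑' n, a n * w⁻¹ ^ (n + 1)) :
    IsUnimodularGeometric a := by
  -- The circle `|w|² = 2 c Re w - 1`: on it and outside it, `Re w ≥ δ` forces `|w|² ≥ R₀² + 1`.
  set c : ℝ := (R₀ ^ 2 + 2) / (2 * δ) + 2 with hc
  set r : ℝ := √(c ^ 2 - 1) with hr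
  have hc2 : 2 < c := by
    have : 0 < (R₀ ^ 2 + 2) / (2 * δ) := by positivity
    linarith
  have hcδ : R₀ ^ 2 + 2 ≤ 2 * c * δ := by
    have : 2 * c * δ = R₀ ^ 2 + 2 + 4 * δ := by rw [hc]; field_simp; ring
    linarith
  have hr2 : r ^ 2 = c ^ 2 - 1 := Real.sq_sqrt (by nlinarith)
  have hrpos : 0 < r := Real.sqrt_pos.2 (by nlinarith)
  have hrc : r < c := by nlinarith
  have hBd : ∀ w : ℂ, r ≤ ‖w - c‖ → DifferentiableAt ℂ B w := by
    intro w hw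
    refine hB w ?_
    by_contra! hcon
    have h1 : r ^ 2 ≤ ‖w - c‖ ^ 2 := by gcongr
    have h2 : ‖w‖ ^ 2 ≤ R₀ ^ 2 := by have := hcon.2; gcongr
    rw [← Complex.normSq_eq_norm_sq, Complex.normSq_apply] at h1 h2
    simp only [Complex.sub_re, Complex.sub_im, Complex.ofReal_re, Complex.ofReal_im] at h1
    nlinarith [mul_le_mul_of_nonneg_left hcon.1 (show 0 ≤ 2 * c by linarith)]
  have hBc : ContinuousOn B (Metric.sphere (c : ℂ) r) := fun w hw =>
    (hBd w (mem_sphere_iff_norm.1 hw).ge).continuousAt.continuousWithinAt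
  have hmom := circleMoment_natCast (fun n => (ha n).le) hrpos hrc hR₀ hBd hBs
  obtain ⟨C, A, β, hA, hβ, hβπ, hbound⟩ := exists_norm_circleMoment_le hrpos.le hrc hBc
  obtain ⟨α, hα⟩ := exists_exp_of_unimodular (differentiable_circleMoment hrpos.le hrc hBc)
    hA hβ hβπ hbound fun n => by rw [hmom, ha]
  have hgeo : ∀ n, a n = circleMoment B c r 0 * Complex.exp α ^ n := by
    intro n
    rw [← hmom n, hα n, ← Complex.exp_nat_mul, mul_comm α]
  exact ⟨_, _, (norm_eq_one_of_geometric ha hgeo).2, hgeo⟩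

/-! ### The two power series -/

lemma differentiable_expTypeSeries {a : ℕ → ℂ} (ha : ∀ n, ‖a n‖ ≤ 1) :
    Differentiable ℂ (expTypeSeries a) := by
  intro z
  refine DifferentiableOn.differentiableAt (s := Metric.ball 0 (‖z‖ + 1)) ?_
    (Metric.isOpen_ball.mem_nhds (by simp))
  refine Complex.differentiableOn_tsum_of_summable_norm
    (Real.summable_pow_div_factorial (‖z‖ + 1)) (fun n => by fun_prop) Metric.isOpen_ball
    fun n w hw => ?_
  rw [mem_ball_zero_iff] at hw
  rw [norm_div, norm_mul, norm_pow, Complex.norm_natCast]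
  gcongr
  calc ‖a n‖ * ‖w‖ ^ n ≤ 1 * (‖z‖ + 1) ^ n := by gcongr; exact ha n
    _ = _ := one_mul _

lemma differentiableOn_shiftedPowerSeries {a : ℕ → ℂ} (ha : ∀ n, ‖a n‖ ≤ 1) :
    DifferentiableOn ℂ (shiftedPowerSeries a) (Metric.ball 0 1) := by
  intro z hz
  rw [mem_ball_zero_iff] at hz
  obtain ⟨ρ, hρ, hρ1⟩ := exists_between hz
  have hρ0 : 0 ≤ ρ := (norm_nonneg z).trans hρ.le
  refine (DifferentiableOn.differentiableAt (s := Metric.ball 0 ρ) ?_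
    (Metric.isOpen_ball.mem_nhds (by simpa using hρ))).differentiableWithinAt
  refine Complex.differentiableOn_tsum_of_summable_norm
    ((summable_nat_add_iff 1).2 (summable_geometric_of_lt_one hρ0 hρ1))
    (fun n => by fun_prop) Metric.isOpen_ball fun n w hw => ?_
  rw [mem_ball_zero_iff] at hw
  rw [norm_mul, norm_pow]
  calc ‖a n‖ * ‖w‖ ^ (n + 1) ≤ 1 * ρ ^ (n + 1) := by gcongr; exact ha n
    _ = _ := one_mul _

lemma differentiableAt_shiftedPowerSeries_inv {a : ℕ → ℂ} (ha : ∀ n, ‖a n‖ ≤ 1) {w : ℂ}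
    (hw : 1 < ‖w‖) : DifferentiableAt ℂ (fun w => shiftedPowerSeries a w⁻¹) w := by
  have hw0 : w ≠ 0 := norm_pos_iff.1 (one_pos.trans hw)
  refine DifferentiableAt.comp w ((differentiableOn_shiftedPowerSeries ha).differentiableAt
    (Metric.isOpen_ball.mem_nhds ?_)) (differentiableAt_inv hw0)
  rw [mem_ball_zero_iff, norm_inv]
  exact inv_lt_one_of_one_lt₀ hw

lemma IsUnimodularGeometric.of_mul_pow {a : ℕ → ℂ} {v : ℂ} (hv : ‖v‖ = 1)
    (h : IsUnimodularGeometric fun n => a n * v ^ n) : IsUnimodularGeometric a := by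
  obtain ⟨c, b, hb, h⟩ := h
  refine ⟨c, b / v, by rw [norm_div, hb, hv, div_one], fun n => ?_⟩
  have hv0 : v ≠ 0 := norm_pos_iff.1 (by rw [hv]; exact one_pos)
  have := h n
  rw [div_pow, ← mul_div_assoc, eq_div_iff (pow_ne_zero n hv0)]
  exact this

/-! ### Exponential decay on a ray and the Laplace transform -/

lemma integrableOn_pow_mul_exp_neg {s : ℝ} (hs : 0 < s) (n : ℕ) :
    MeasureTheory.IntegrableOn (fun t : ℝ => t ^ n * Real.exp (-(s * t))) (Set.Ioi 0) := by
  have := integrableOn_rpow_mul_exp_neg_mul_rpow (p := 1) (s := n) (b := s)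
    (by linarith [n.cast_nonneg (α := ℝ)]) one_pos hs
  simpa [neg_mul] using this

lemma integral_pow_mul_exp_neg {s : ℝ} (hs : 0 < s) (n : ℕ) :
    ∫ t in Set.Ioi (0 : ℝ), t ^ n * Real.exp (-(s * t)) = n.factorial * s⁻¹ ^ (n + 1) := by
  have := Real.integral_rpow_mul_exp_neg_mul_Ioi (a := n + 1) (r := s) (by positivity) hs
  rw [Real.Gamma_nat_eq_factorial] at this
  simp only [add_sub_cancel_right, Real.rpow_natCast, one_div] at this
  rw [this, mul_comm]
  norm_cast

/-- The Laplace transform of `t ↦ f (-t)`, with the sign that makes it equal to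
`∑ aₙ / w ^ (n + 1)` for `Re w < -1` when `f z = ∑ aₙ zⁿ / n!`. -/
noncomputable def negLaplace (f : ℂ → ℂ) (w : ℂ) : ℂ :=
  -∫ t in Set.Ioi (0 : ℝ), f (-t) * Complex.exp (w * t)

lemma differentiableAt_negLaplace {f : ℂ → ℂ} (hf : Continuous f) {C ε : ℝ}
    (hb : ∀ t : ℝ, 0 ≤ t → ‖f (-t)‖ ≤ C * Real.exp (-(ε * t))) {w₀ : ℂ} (hw₀ : w₀.re < ε) :
    DifferentiableAt ℂ (negLaplace f) w₀ := by
  set ρ : ℝ := (ε - w₀.re) / 2 with hρ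
  have hρ0 : 0 < ρ := by linarith
  have hC : 0 ≤ C :=
    nonneg_of_mul_nonneg_left ((norm_nonneg _).trans (hb 0 le_rfl)) (Real.exp_pos _)
  have hmain : ∀ (w : ℂ) (t : ℝ), 0 ≤ t → w.re ≤ ε - ρ →
      ‖f (-t) * Complex.exp (w * t)‖ ≤ C * Real.exp (-(ρ * t)) := by
    intro w t ht hw
    rw [norm_mul, Complex.norm_exp, Complex.re_mul_ofReal]
    calc ‖f (-t)‖ * Real.exp (w.re * t) ≤ C * Real.exp (-(ε * t)) * Real.exp ((ε - ρ) * t) := by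
          gcongr
          exact hb t ht
      _ = C * Real.exp (-(ρ * t)) := by rw [mul_assoc, ← Real.exp_add]; ring_nf
  have hcont : ∀ w : ℂ, Continuous fun t : ℝ => f (-t) * Complex.exp (w * t) := by
    intro w; fun_prop
  refine DifferentiableAt.fun_neg ?_
  refine HasDerivAt.differentiableAt (hasDerivAt_integral_of_dominated_loc_of_deriv_le
    (F := fun w (t : ℝ) => f (-t) * Complex.exp (w * t))
    (F' := fun w (t : ℝ) => f (-t) * Complex.exp (w * t) * t)
    (bound := fun t => C * (t ^ 1 * Real.exp (-(ρ * t))))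
    (Metric.ball_mem_nhds w₀ hρ0) ?_ ?_ ?_ ?_ ?_ ?_).2
  · exact Eventually.of_forall fun w => (hcont w).aestronglyMeasurable
  · refine MeasureTheory.Integrable.mono'
      ((integrableOn_pow_mul_exp_neg hρ0 0).const_mul C) (hcont w₀).aestronglyMeasurable ?_
    refine (MeasureTheory.ae_restrict_iff' measurableSet_Ioi).2 (Eventually.of_forall fun t ht => ?_)
    simpa using hmain w₀ t (le_of_lt ht) (by linarith)
  · exact ((hcont w₀).mul Complex.continuous_ofReal).aestronglyMeasurable
  · refine (MeasureTheory.ae_restrict_iff' measurableSet_Ioi).2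
      (Eventually.of_forall fun t ht w hw => ?_)
    have ht0 : 0 ≤ t := le_of_lt ht
    have hw' : w.re ≤ ε - ρ := by
      rw [mem_ball_iff_norm] at hw
      have := (Complex.re_le_norm (w - w₀)).trans hw.le
      rw [Complex.sub_re] at this
      linarith
    rw [norm_mul, Complex.norm_of_nonneg ht0, pow_one]
    calc _ ≤ C * Real.exp (-(ρ * t)) * t := by
          gcongr; exact hmain w t ht0 hw'
      _ = _ := by ring
  · exact (integrableOn_pow_mul_exp_neg hρ0 1).const_mul C
  · refine Eventually.of_forall fun t w _ => ?_
    have h1 : HasDerivAt (fun w : ℂ => w * t) (1 * t) w := (hasDerivAt_id w).mul_const _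
    exact (h1.cexp.const_mul (f (-t))).congr_deriv (by ring)

/-- Termwise integration, at real points of the half-plane `Re w < -1`. This suffices for the
identity theorem. -/
lemma negLaplace_expTypeSeries {a : ℕ → ℂ} (ha : ∀ n, ‖a n‖ ≤ 1) {s : ℝ} (hs : 1 < s) :
    negLaplace (expTypeSeries a) (-s : ℝ) = shiftedPowerSeries a ((-s : ℝ) : ℂ)⁻¹ := by
  have hs0 : 0 < s := by linarith
  set F : ℕ → ℝ → ℂ := fun n t => (a n * (-1) ^ n / n.factorial) *
    ((t ^ n * Real.exp (-(s * t)) : ℝ) : ℂ) with hF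
  have hint : ∀ n, MeasureTheory.Integrable (F n)
      (MeasureTheory.volume.restrict (Set.Ioi 0)) := fun n =>
    ((integrableOn_pow_mul_exp_neg hs0 n).ofReal).const_mul _
  have hval : ∀ n, ∫ t in Set.Ioi (0 : ℝ), F n t = a n * (-1) ^ n * (s : ℂ)⁻¹ ^ (n + 1) := by
    intro n
    simp only [hF]
    rw [MeasureTheory.integral_const_mul, integral_complex_ofReal, integral_pow_mul_exp_neg hs0]
    have : (n.factorial : ℂ) ≠ 0 := by exact_mod_cast n.factorial_ne_zero
    push_cast
    field_simp
  have hnorm : ∀ n, ∫ t in Set.Ioi (0 : ℝ), ‖F n t‖ = ‖a n‖ * s⁻¹ ^ (n + 1) := by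
    intro n
    have : ∫ t in Set.Ioi (0 : ℝ), ‖F n t‖ =
        ∫ t in Set.Ioi (0 : ℝ), (‖a n‖ / n.factorial) * (t ^ n * Real.exp (-(s * t))) := by
      refine MeasureTheory.setIntegral_congr_fun measurableSet_Ioi fun t ht => ?_
      have ht0 : (0 : ℝ) ≤ t := le_of_lt ht
      simp only [hF]
      rw [norm_mul, Complex.norm_of_nonneg (by positivity)]
      simp
    rw [this, MeasureTheory.integral_const_mul, integral_pow_mul_exp_neg hs0]
    field_simp
  have hsum : Summable fun n => ∫ t in Set.Ioi (0 : ℝ), ‖F n t‖ := by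
    simp only [hnorm]
    refine Summable.of_nonneg_of_le (fun n => by positivity) (fun n => ?_)
      ((summable_nat_add_iff 1).2 (summable_geometric_of_lt_one (r := s⁻¹) (by positivity)
        (inv_lt_one_of_one_lt₀ hs)))
    exact mul_le_of_le_one_left (by positivity) (ha n)
  have key := (MeasureTheory.hasSum_integral_of_summable_integral_norm hint hsum).tsum_eq
  have hpt : ∀ t : ℝ, expTypeSeries a (-t) * Complex.exp ((-s : ℝ) * t) = ∑' n, F n t := by
    intro t
    rw [expTypeSeries, ← tsum_mul_right]
    refine tsum_congr fun n => ?_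
    simp only [hF]
    push_cast
    rw [neg_pow]
    ring_nf
  rw [negLaplace]
  simp only [hpt]
  rw [← key, shiftedPowerSeries, ← tsum_neg]
  refine tsum_congr fun n => ?_
  rw [hval]
  push_cast
  rw [inv_neg, neg_pow _ (n + 1)]
  ring

/-- If `f` decays exponentially along the negative axis, its Borel transform is the Laplace
transform there, which is holomorphic in a half-plane `Re w < ε`. -/
theorem isUnimodularGeometric_of_decay {a : ℕ → ℂ} (ha : ∀ n, ‖a n‖ = 1) {C ε : ℝ} (hε : 0 < ε)
    (hb : ∀ t : ℝ, 0 ≤ t → ‖expTypeSeries a (-t)‖ ≤ C * Real.exp (-(ε * t))) :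
    IsUnimodularGeometric a := by
  have ha' : ∀ n, ‖a n‖ ≤ 1 := fun n => (ha n).le
  set L := negLaplace (expTypeSeries a) with hLdef
  set S : ℂ → ℂ := fun w => shiftedPowerSeries a w⁻¹ with hSdef
  set η : ℝ := min ε 1 with hη
  have hη0 : 0 < η := lt_min hε one_pos
  have hL : ∀ w : ℂ, w.re < η → DifferentiableAt ℂ L w := fun w hw =>
    differentiableAt_negLaplace (differentiable_expTypeSeries ha').continuous hb
      (hw.trans_le (min_le_left _ _))
  have hS : ∀ w : ℂ, 1 < ‖w‖ → DifferentiableAt ℂ S w := fun w hw =>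
    differentiableAt_shiftedPowerSeries_inv ha' hw
  have hident : ∀ {U : Set ℂ}, IsOpen U → Convex ℝ U → (∀ w ∈ U, w.re < η ∧ 1 < ‖w‖) →
      ∀ w₁ ∈ U, (∃ᶠ w in 𝓝[≠] w₁, L w = S w) → Set.EqOn L S U := by
    intro U hUo hUc hU w₁ hw₁ hfr
    refine AnalyticOnNhd.eqOn_of_preconnected_of_frequently_eq
      (DifferentiableOn.analyticOnNhd (fun w hw => ?_) hUo)
      (DifferentiableOn.analyticOnNhd (fun w hw => ?_) hUo) hUc.isPreconnected hw₁ hfr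
    · exact (hL w (hU w hw).1).differentiableWithinAt
    · exact (hS w (hU w hw).2).differentiableWithinAt
  have hleft : Set.EqOn L S {w | w.re < -1} := by
    refine hident (isOpen_lt Complex.continuous_re continuous_const)
      (convex_halfSpace_re_lt _) (fun w hw => ⟨?_, ?_⟩) ((-2 : ℝ) : ℂ) ?_ ?_
    · exact lt_trans hw (by linarith)
    · have h1 := (abs_le.1 (Complex.abs_re_le_norm w)).1
      have h2 : w.re < -1 := hw
      linarith
    · simp
    · have ht : Tendsto (fun x : ℝ => (x : ℂ)) (𝓝[≠] (-2)) (𝓝[≠] ((-2 : ℝ) : ℂ)) := by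
        refine tendsto_nhdsWithin_iff.2 ⟨?_, ?_⟩
        · exact Complex.continuous_ofReal.continuousAt.mono_left nhdsWithin_le_nhds
        · filter_upwards [self_mem_nhdsWithin] with x hx
          exact fun h => hx (Complex.ofReal_injective h)
      refine ht.frequently (Eventually.frequently ?_)
      filter_upwards [nhdsWithin_le_nhds (gt_mem_nhds (show (-2 : ℝ) < -1 by norm_num))] with x hx
      have := negLaplace_expTypeSeries ha' (s := -x) (by linarith)
      rwa [neg_neg] at this
  have hlefto : IsOpen {w : ℂ | w.re < -1} := isOpen_lt Complex.continuous_re continuous_const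
  have hfreq : ∀ w₁ : ℂ, w₁.re < -1 → ∃ᶠ w in 𝓝[≠] w₁, L w = S w := fun w₁ hw₁ =>
    Eventually.frequently (nhdsWithin_le_nhds (eventually_of_mem (hlefto.mem_nhds hw₁) hleft))
  have hup : Set.EqOn L S ({w | w.re < η} ∩ {w | 1 < w.im}) := by
    refine hident ((isOpen_lt Complex.continuous_re continuous_const).inter
      (isOpen_lt continuous_const Complex.continuous_im))
      ((convex_halfSpace_re_lt _).inter (convex_halfSpace_im_gt _)) (fun w hw => ⟨hw.1, ?_⟩)
      ⟨-2, 2⟩ ⟨?_, ?_⟩ (hfreq _ (by norm_num))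
    · exact lt_of_lt_of_le hw.2 (Complex.im_le_norm w)
    · change (-2 : ℝ) < η; linarith
    · change (1 : ℝ) < 2; norm_num
  have hdown : Set.EqOn L S ({w | w.re < η} ∩ {w | w.im < -1}) := by
    refine hident ((isOpen_lt Complex.continuous_re continuous_const).inter
      (isOpen_lt Complex.continuous_im continuous_const))
      ((convex_halfSpace_re_lt _).inter (convex_halfSpace_im_lt _)) (fun w hw => ⟨hw.1, ?_⟩)
      ⟨-2, -2⟩ ⟨?_, ?_⟩ (hfreq _ (by norm_num))
    · have h1 := (abs_le.1 (Complex.abs_im_le_norm w)).1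
      have h2 : w.im < -1 := hw.2
      linarith
    · change (-2 : ℝ) < η; linarith
    · change (-2 : ℝ) < -1; norm_num
  -- Outside a large disc the overlap of the two domains is covered by the three convex sets.
  have hover : ∀ w : ℂ, w.re < η → 5 < ‖w‖ → L w = S w := by
    intro w hw hw5
    by_cases h1 : w.re < -1
    · exact hleft h1
    by_cases h2 : 1 < w.im
    · exact hup ⟨hw, h2⟩
    by_cases h3 : w.im < -1
    · exact hdown ⟨hw, h3⟩
    exfalso
    have h4 : |w.re| ≤ 1 := abs_le.2 ⟨not_lt.1 h1, hw.le.trans (min_le_right _ _)⟩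
    have h5 : |w.im| ≤ 1 := abs_le.2 ⟨not_lt.1 h3, not_lt.1 h2⟩
    linarith [Complex.norm_le_abs_re_add_abs_im w]
  classical
  set B : ℂ → ℂ := fun w => if w.re < η then L w else S w with hBdef
  have hBS : ∀ w : ℂ, 5 < ‖w‖ → B w = S w := by
    intro w hw
    rw [hBdef]
    dsimp only
    split_ifs with h
    · exact hover w h hw
    · rfl
  refine isUnimodularGeometric_of_continuation ha hη0 (R₀ := 5) (by norm_num) (B := B)
    (fun w hw => ?_) hBS
  rcases hw with hw | hw
  · refine (hL w hw).congr_of_eventuallyEq ?_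
    filter_upwards [(isOpen_lt Complex.continuous_re continuous_const).mem_nhds hw] with z hz
    exact if_pos hz
  · refine (hS w (by linarith)).congr_of_eventuallyEq ?_
    filter_upwards [(isOpen_lt continuous_const continuous_norm).mem_nhds hw] with z hz
    exact hBS z hz

/-! ### The indicator -/

lemma exists_bound_of_plIndicator_neg {f : ℂ → ℂ} (hf : Continuous f) {θ : ℝ}
    (h : plIndicator f θ < 0) : ∃ C ε : ℝ, 0 < ε ∧ ∀ t : ℝ, 0 ≤ t →
      ‖f ((t : ℂ) * Complex.exp ((θ : ℂ) * Complex.I))‖ ≤ C * Real.exp (-(ε * t)) := by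
  obtain ⟨q, hq1, hq2⟩ := EReal.lt_iff_exists_real_btwn.1 h
  have hq0 : q < 0 := by exact_mod_cast hq2
  have hev := eventually_lt_of_limsup_lt hq1
  obtain ⟨R, hR⟩ := eventually_atTop.1 (hev.and (eventually_gt_atTop 0))
  set g : ℝ → ℂ := fun t => f ((t : ℂ) * Complex.exp ((θ : ℂ) * Complex.I)) with hg
  have hgc : Continuous g := by fun_prop
  obtain ⟨M, hM⟩ := isCompact_Icc.exists_bound_of_continuousOn (s := Set.Icc 0 R)
    hgc.continuousOn
  refine ⟨max 1 (M * Real.exp (-q * R)), -q, by linarith, fun t ht => ?_⟩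
  rcases le_total R t with hRt | hRt
  · obtain ⟨h1, ht0⟩ := hR t hRt
    refine le_trans ?_ (mul_le_mul_of_nonneg_right (le_max_left _ _) (Real.exp_pos _).le)
    rw [one_mul]
    by_cases h0 : g t = 0
    · change ‖g t‖ ≤ _
      rw [h0, norm_zero]
      positivity
    · have hpos := norm_pos_iff.2 h0
      change ((t⁻¹ : ℝ) : EReal) * ENNReal.log ‖g t‖ₑ < q at h1
      rw [← ofReal_norm, ENNReal.log_ofReal_of_pos hpos, ← EReal.coe_mul,
        EReal.coe_lt_coe_iff, inv_mul_lt_iff₀ ht0, Real.log_lt_iff_lt_exp hpos] at h1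
      change ‖g t‖ ≤ _
      refine h1.le.trans (le_of_eq ?_)
      congr 1; ring
  · have hMt := hM t ⟨ht, hRt⟩
    have hM0 := (norm_nonneg _).trans hMt
    refine hMt.trans ?_
    calc M ≤ M * Real.exp (-q * R - -q * t) :=
          le_mul_of_one_le_right hM0 (Real.one_le_exp (by nlinarith))
      _ = M * Real.exp (-q * R) * Real.exp (-(-q * t)) := by
          rw [mul_assoc, ← Real.exp_add]; ring_nf
      _ ≤ _ := by gcongr; exact le_max_right _ _

lemma isUnimodularGeometric_of_plIndicator_neg {a : ℕ → ℂ} (ha : ∀ n, ‖a n‖ = 1) {θ : ℝ}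
    (h : plIndicator (expTypeSeries a) θ < 0) : IsUnimodularGeometric a := by
  obtain ⟨C, ε, hε, hb⟩ := exists_bound_of_plIndicator_neg
    (differentiable_expTypeSeries fun n => (ha n).le).continuous h
  -- This rotation takes the negative axis to the ray of direction `θ`.
  set v : ℂ := -Complex.exp ((θ : ℂ) * Complex.I) with hv
  have hv1 : ‖v‖ = 1 := by rw [hv, norm_neg, Complex.norm_exp_ofReal_mul_I]
  refine IsUnimodularGeometric.of_mul_pow hv1 (isUnimodularGeometric_of_decay (ε := ε) (C := C)
    (fun n => by rw [norm_mul, norm_pow, ha, hv1, one_pow, one_mul]) hε fun t ht => ?_)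
  refine le_of_eq_of_le (congrArg norm ?_) (hb t ht)
  rw [expTypeSeries, expTypeSeries]
  refine tsum_congr fun n => ?_
  rw [mul_assoc, ← mul_pow, hv]
  ring_nf

lemma expTypeSeries_of_geometric {a : ℕ → ℂ} {c b : ℂ} (h : ∀ n, a n = c * b ^ n) (z : ℂ) :
    expTypeSeries a z = c * Complex.exp (b * z) := by
  rw [expTypeSeries, Complex.exp_eq_exp_ℂ, NormedSpace.exp_eq_tsum_div, ← tsum_mul_left]
  refine tsum_congr fun n => ?_
  rw [h, mul_pow]; ring

lemma exists_plIndicator_neg {c b : ℂ} (hc : ‖c‖ = 1) (hb : ‖b‖ = 1) :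
    ∃ θ : ℝ, plIndicator (fun z => c * Complex.exp (b * z)) θ < 0 := by
  have hdir : Complex.exp (((-conj b).arg : ℂ) * Complex.I) = -conj b := by
    have := Complex.norm_mul_exp_arg_mul_I (-conj b)
    rwa [norm_neg, RCLike.norm_conj, hb, Complex.ofReal_one, one_mul] at this
  refine ⟨(-conj b).arg, ?_⟩
  have hlim : plIndicator (fun z => c * Complex.exp (b * z)) (-conj b).arg =
      ((-1 : ℝ) : EReal) := by
    rw [plIndicator, ← limsup_const (f := (atTop : Filter ℝ)) ((-1 : ℝ) : EReal)]
    refine limsup_congr ?_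
    filter_upwards [eventually_gt_atTop 0] with r hr
    have hexp : b * ((r : ℂ) * -conj b) = ((-r : ℝ) : ℂ) := by
      rw [mul_left_comm, mul_neg, Complex.mul_conj, Complex.normSq_eq_norm_sq, hb]
      push_cast; ring
    rw [hdir, hexp, ← ofReal_norm, norm_mul, hc, one_mul, Complex.norm_exp, Complex.ofReal_re,
      ENNReal.log_ofReal_of_pos (Real.exp_pos _), Real.log_exp, ← EReal.coe_mul]
    congr 1
    field_simp
  rw [hlim]
  exact_mod_cast neg_one_lt_zero

/-! ### Continuation of the power series to infinity -/

lemma isUnimodularGeometric_of_continuesToInfty {a : ℕ → ℂ} (ha : ∀ n, ‖a n‖ = 1) {H : Set ℂ}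
    (hH : IsOpenHalfPlane H) (h0 : (0 : ℂ) ∈ H)
    (hc : ContinuesToInftyThrough (shiftedPowerSeries a) H) : IsUnimodularGeometric a := by
  obtain ⟨u, t, hu, rfl⟩ := hH
  obtain ⟨Φ, Ψ, hΦ, hΦG, hΨ, R, hΦΨ⟩ := hc
  have ht : 0 < t := by simpa using h0
  have hun : 0 < ‖u‖ := norm_pos_iff.2 hu
  -- After the rotation by `v` the half-plane is `Re z < τ`.
  set v : ℂ := conj u / ‖u‖ with hv
  have hv1 : ‖v‖ = 1 := by
    rw [hv, norm_div, RCLike.norm_conj, Complex.norm_real, norm_norm, div_self hun.ne']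
  have hv0 : v ≠ 0 := norm_pos_iff.1 (by rw [hv1]; exact one_pos)
  have huv : u * v = (‖u‖ : ℂ) := by
    have : (‖u‖ : ℂ) ≠ 0 := by exact_mod_cast hun.ne'
    rw [hv, mul_div_assoc', Complex.mul_conj, Complex.normSq_eq_norm_sq]
    push_cast
    field_simp
  set τ : ℝ := t / ‖u‖ with hτ
  have hτ0 : 0 < τ := by positivity
  have hmemH : ∀ w : ℂ, w ≠ 0 → w.re < τ * ‖w‖ ^ 2 →
      v / w ∈ {z : ℂ | (u * z).re < t} := by
    intro w hw hwre
    have hw2 : 0 < ‖w‖ ^ 2 := by have := norm_pos_iff.2 hw; positivity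
    change (u * (v / w)).re < t
    rw [← mul_div_assoc, huv, div_eq_mul_inv, Complex.re_ofReal_mul, Complex.inv_re,
      Complex.normSq_eq_norm_sq, ← mul_div_assoc, div_lt_iff₀ hw2]
    have : ‖u‖ * w.re < ‖u‖ * (τ * ‖w‖ ^ 2) := by gcongr
    refine this.trans_eq ?_
    rw [hτ]; field_simp
  obtain ⟨ρ₀, hρ₀, hΨd⟩ := Metric.eventually_nhds_iff_ball.1 hΨ.eventually_analyticAt
  set ρ : ℝ := min ρ₀ (1 / (|R| + 1)) with hρ
  have hρpos : 0 < ρ := by positivity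
  have hρ1 : ρ ≤ 1 := (min_le_right _ _).trans
    ((div_le_one (by positivity)).2 (by linarith [abs_nonneg R]))
  -- The two continuations agree where both are used.
  have hagree : ∀ w : ℂ, w ≠ 0 → ‖w‖ < ρ → w.re < τ * ‖w‖ ^ 2 → Φ (v / w) = Ψ (w / v) := by
    intro w hw hwρ hwre
    have hwpos := norm_pos_iff.2 hw
    rw [hΦΨ _ (hmemH w hw hwre), inv_div]
    rw [norm_div, hv1, lt_div_iff₀ hwpos]
    have h1 : ‖w‖ * (|R| + 1) < 1 := by
      rw [← lt_div_iff₀ (by positivity)]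
      exact hwρ.trans_le (min_le_right _ _)
    nlinarith [le_abs_self R]
  classical
  set B : ℂ → ℂ := fun w => if ‖w‖ < ρ / 2 then v⁻¹ * Ψ (w / v) else v⁻¹ * Φ (v / w) with hB
  -- For `|w| ≥ ρ / 4` and `Re w < δ`, the point `v / w` lies in the half-plane.
  set δ : ℝ := τ * (ρ / 4) ^ 2 with hδ
  have hδ0 : 0 < δ := by positivity
  refine IsUnimodularGeometric.of_mul_pow hv1 (isUnimodularGeometric_of_continuation
    (fun n => by rw [norm_mul, norm_pow, ha, hv1, one_pow, one_mul]) hδ0 le_rfl (B := B)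
    (fun w hw => ?_) fun w hw => ?_)
  · by_cases hwρ : ‖w‖ < ρ / 2
    · have hd : DifferentiableAt ℂ (fun w => v⁻¹ * Ψ (w / v)) w := by
        have h1 : DifferentiableAt ℂ Ψ (w / v) := by
          refine (hΨd _ ?_).differentiableAt
          rw [mem_ball_zero_iff, norm_div, hv1, div_one]
          linarith [min_le_left ρ₀ (1 / (|R| + 1))]
        exact (DifferentiableAt.comp w h1 (by fun_prop)).const_mul _
      refine hd.congr_of_eventuallyEq ?_
      filter_upwards [(isOpen_lt continuous_norm continuous_const).mem_nhds hwρ] with z hz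
      exact if_pos hz
    · set U : Set ℂ := {z | ρ / 4 < ‖z‖} ∩ ({z | z.re < δ} ∪ {z | 1 < ‖z‖}) with hU
      have hUo : IsOpen U := (isOpen_lt continuous_const continuous_norm).inter
        ((isOpen_lt Complex.continuous_re continuous_const).union
          (isOpen_lt continuous_const continuous_norm))
      have hwU : w ∈ U := ⟨by change ρ / 4 < ‖w‖; linarith, hw⟩
      have hne : ∀ z ∈ U, z ≠ 0 := fun z hz =>
        norm_pos_iff.1 (lt_trans (by positivity) hz.1)
      have hre : ∀ z ∈ U, z.re < δ → z.re < τ * ‖z‖ ^ 2 := by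
        intro z hz hzδ
        refine hzδ.trans_le ?_
        have hzρ : ρ / 4 ≤ ‖z‖ := le_of_lt hz.1
        rw [hδ]
        gcongr
      have hd : DifferentiableAt ℂ (fun z => v⁻¹ * Φ (v / z)) w := by
        have h1 : DifferentiableAt ℂ Φ (v / w) := by
          refine (hΦ _ ?_).differentiableAt
          rcases hw with hw | hw
          · exact Or.inr (hmemH w (hne w hwU) (hre w hwU hw))
          · refine Or.inl ?_
            rw [mem_ball_zero_iff, norm_div, hv1]
            exact (div_lt_one (by linarith)).2 hw
        have h2 : DifferentiableAt ℂ (fun z => v / z) w :=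
          (differentiableAt_const v).div differentiableAt_id (hne w hwU)
        exact (DifferentiableAt.comp w h1 h2).const_mul _
      refine hd.congr_of_eventuallyEq ?_
      filter_upwards [hUo.mem_nhds hwU] with z hz
      by_cases hzρ : ‖z‖ < ρ / 2
      · have hzδ : z.re < δ := by
          refine hz.2.resolve_right fun h => ?_
          have : 1 < ‖z‖ := h
          linarith
        simp only [hB, if_pos hzρ]
        rw [hagree z (hne z hz) (by linarith) (hre z hz hzδ)]
      · simp only [hB, if_neg hzρ]
  · have hwρ : ¬ ‖w‖ < ρ / 2 := by
      rw [not_lt]; linarith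
    simp only [hB, if_neg hwρ]
    rw [hΦG _ (by
      rw [mem_ball_zero_iff, norm_div, hv1]
      exact (div_lt_one (by linarith)).2 hw), shiftedPowerSeries, ← tsum_mul_left]
    refine tsum_congr fun n => ?_
    rw [div_eq_mul_inv, mul_pow, pow_succ v]
    field_simp

lemma exists_continuesToInfty_of_geometric {a : ℕ → ℂ} {c b : ℂ} (hb : ‖b‖ = 1)
    (h : ∀ n, a n = c * b ^ n) : ∃ H : Set ℂ, IsOpenHalfPlane H ∧ (0 : ℂ) ∈ H ∧
      ContinuesToInftyThrough (shiftedPowerSeries a) H := by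
  have hb0 : b ≠ 0 := norm_pos_iff.1 (by rw [hb]; exact one_pos)
  have hne : ∀ z ∈ Metric.ball (0 : ℂ) 1 ∪ {z : ℂ | (b * z).re < 1 / 2}, 1 - b * z ≠ 0 := by
    intro z hz h1
    rw [sub_eq_zero] at h1
    rcases hz with hz | hz
    · have := congrArg norm h1
      rw [norm_one, norm_mul, hb, one_mul] at this
      rw [mem_ball_zero_iff] at hz
      linarith
    · have h2 : (b * z).re < 1 / 2 := hz
      rw [← h1, Complex.one_re] at h2
      norm_num at h2
  refine ⟨{z | (b * z).re < 1 / 2}, ⟨b, 1 / 2, hb0, rfl⟩, by simp,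
    fun z => c * z / (1 - b * z), fun s => c / (s - b), fun z hz => ?_, fun z hz => ?_, ?_,
    0, fun z hz hz0 => ?_⟩
  · exact (by fun_prop : AnalyticAt ℂ (fun z => c * z) z).div
      (by fun_prop : AnalyticAt ℂ (fun z => 1 - b * z) z) (hne z hz)
  · rw [shiftedPowerSeries]
    have hlt : ‖b * z‖ < 1 := by
      rw [norm_mul, hb, one_mul]; exact mem_ball_zero_iff.1 hz
    dsimp only
    rw [div_eq_mul_inv, ← tsum_geometric_of_norm_lt_one hlt, ← tsum_mul_left]
    refine tsum_congr fun n => ?_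
    rw [h, mul_pow]; ring
  · exact analyticAt_const.div (by fun_prop) (by simpa using hb0)
  · have hz0' : z ≠ 0 := norm_pos_iff.1 hz0
    have h1 := hne z (Or.inr hz)
    have h2 : z⁻¹ - b = (1 - b * z) / z := by field_simp
    dsimp only
    rw [h2, div_div_eq_mul_div]

theorem theorem1 (a : ℕ → ℂ) (ha : ∀ n, ‖a n‖ = 1) :
    ((∀ θ : ℝ, 0 ≤ plIndicator (expTypeSeries a) θ) ↔ ¬ IsUnimodularGeometric a) ∧
    (∀ c b : ℂ, (∀ n, a n = c * b ^ n) →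
      ‖c‖ = 1 ∧ ‖b‖ = 1 ∧ ∀ z : ℂ, expTypeSeries a z = c * Complex.exp (b * z)) ∧
    ((¬ ∃ H : Set ℂ, IsOpenHalfPlane H ∧ (0 : ℂ) ∈ H ∧
        ContinuesToInftyThrough (shiftedPowerSeries a) H) ↔ ¬ IsUnimodularGeometric a) := by
  refine ⟨⟨?_, fun hgeo θ => ?_⟩, fun c b h => ?_, not_congr ⟨?_, ?_⟩⟩
  · rintro hpos ⟨c, b, hb, h⟩
    obtain ⟨θ, hθ⟩ := exists_plIndicator_neg (norm_eq_one_of_geometric ha h).1 hb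
    rw [← funext (expTypeSeries_of_geometric h)] at hθ
    exact (hpos θ).not_gt hθ
  · by_contra! hneg
    exact hgeo (isUnimodularGeometric_of_plIndicator_neg ha hneg)
  · exact ⟨(norm_eq_one_of_geometric ha h).1, (norm_eq_one_of_geometric ha h).2,
      expTypeSeries_of_geometric h⟩
  · rintro ⟨H, hH, h0, hc⟩
    exact isUnimodularGeometric_of_continuesToInfty ha hH h0 hc
  · rintro ⟨c, b, hb, h⟩
    exact exists_continuesToInfty_of_geometric hb h
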